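/- Let $\mathbb S^2\subset\mathbb R^3$ be the unit sphere with its round metric $g_0$, polar angle $\theta\in[0,\pi]$ and azimuth $\varphi\in(-\pi,\pi]$, and let $\mathcal N=(0,0,1)$, $\mathcal S=(0,0,-1)$. For $n\ge 1$ put $\varphi_n=1/(n\pi)$, let $q_n$ be the point with $\theta=\pi/2$, $\varphi=\varphi_n$, and $p_n$ the point with $\theta=\pi/2$, $\varphi=(\varphi_n+\varphi_{n+1})/2$. Let $\Omega\in C^\infty(\mathbb S^2)$ satisfy: (a) $\Omega\ge 1$; (b) $\Omega=1$ on the meridians of azimuth $\varphi_n$, $n\ge1$; (c) for some $0<\varepsilon'<\varepsilon''<\pi/2$ one has $\Omega=1$ where $|\theta-\pi/2|>\varepsilon''$, and $\Omega>1$ where $|\theta-\pi/2|<\varepsilon'$, $0<\varphi<\pi/2$ and $\varphi\ne\varphi_n$ for all $n\ge1$. Then there exist strictly decreasing sequences of positive numbers $\nu_n\to0$ and $\varepsilon_n\to0$ such that, denoting by $V_n$ the open $g_0$-ball of diameter $\varepsilon_n$ centred at $q_n$, the closures $\overline{V}_n$ are pairwise disjoint and contain no $p_m$, and the following holds. Call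 $f\in C^\infty(\mathbb S^2)$ admissible if $f\ge0$, $f=0$ outside $\bigcup_n V_n$, and $f(q_n)>0$ and $f\le\nu_n$ on $V_n$ for every $n$. Admissible functions exist; and for every admissible $f$ the function $\tilde\Omega=\Omega-f$ is positive and, with $g^\star=\tilde\Omega g_0$, there is no absolutely continuous curve $\gamma:[a,b]\to\mathbb S^2$ from $\mathcal N$ to $\mathcal S$ which passes through $p_n$ for some $n\ge1$ and has $g^\star$-length $L_{g^\star}(\gamma)\le\pi$. -/

import Mathlib

open Set Filter Topology MeasureTheory
open scoped Manifold ContDiff ENNReal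

noncomputable section

namespace SphereExample

/-- Euclidean three-space. -/
abbrev E3 : Type := EuclideanSpace ℝ (Fin 3)

/-- The unit sphere of Euclidean three-space, with Mathlib's smooth structure. -/
abbrev S2 : Type := Metric.sphere (0 : E3) 1

/-- The point with polar angle `θ` and azimuth `φ`. -/
def pt (θ φ : ℝ) : S2 :=
  ⟨!₂[Real.sin θ * Real.cos φ, Real.sin θ * Real.sin φ, Real.cos θ], by
    rw [mem_sphere_zero_iff_norm, EuclideanSpace.norm_eq, Real.sqrt_eq_one]
    simp only [Fin.sum_univ_three, Real.norm_eq_abs, sq_abs]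
    simp only [Matrix.cons_val_zero, Matrix.cons_val_one, Matrix.cons_val]
    nlinarith [Real.sin_sq_add_cos_sq θ, Real.sin_sq_add_cos_sq φ]⟩

/-- The north pole `(0, 0, 1)`. -/
def northPole : S2 :=
  ⟨!₂[0, 0, 1], by
    rw [mem_sphere_zero_iff_norm, EuclideanSpace.norm_eq]
    simp [Fin.sum_univ_three]⟩

/-- The south pole `(0, 0, -1)`. -/
def southPole : S2 :=
  ⟨!₂[0, 0, -1], by
    rw [mem_sphere_zero_iff_norm, EuclideanSpace.norm_eq]
    simp [Fin.sum_univ_three]⟩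

/-- The azimuths `1/π, 1/(2π), 1/(3π), …`; the sequence is indexed from `0`, so that the index `n`
here stands for the positive integer `n + 1`. -/
def azimuth (n : ℕ) : ℝ := 1 / (((n : ℝ) + 1) * Real.pi)

/-- The equatorial point of the meridian of azimuth `azimuth n`. -/
def q (n : ℕ) : S2 := pt (Real.pi / 2) (azimuth n)

/-- The equatorial point midway between `q n` and `q (n + 1)`. -/
def p (n : ℕ) : S2 := pt (Real.pi / 2) ((azimuth n + azimuth (n + 1)) / 2)

/-- The open ball of centre `c` and radius `r` for the distance of the round metric `g₀`, which is
the angle between the two position vectors. -/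
def geoBall (c : S2) (r : ℝ) : Set S2 :=
  {x | InnerProductGeometry.angle (c : E3) (x : E3) < r}

/-- The length of the curve `γ : [a, b] → S2` in the metric `h g₀`, i.e. the integral of
`√(h(γ(t)) g₀(γ'(t), γ'(t)))`. -/
def conformalLength (h : S2 → ℝ) (γ : ℝ → S2) (a b : ℝ) : ℝ≥0∞ :=
  ∫⁻ t in Icc a b, ENNReal.ofReal (√(h (γ t) * ‖deriv (fun s => (γ s : E3)) t‖ ^ 2))

/-- The properties required of the original conformal factor `Ω`. -/
structure IsBaseFactor (Ω : S2 → ℝ) : Prop where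
  smooth : ContMDiff (𝓡 2) 𝓘(ℝ, ℝ) ∞ Ω
  one_le : ∀ x, 1 ≤ Ω x
  eq_one_meridian : ∀ n : ℕ, ∀ θ ∈ Icc 0 Real.pi, Ω (pt θ (azimuth n)) = 1
  band : ∃ ε₁ ε₂ : ℝ, 0 < ε₁ ∧ ε₁ < ε₂ ∧ ε₂ < Real.pi / 2 ∧
    (∀ θ ∈ Icc 0 Real.pi, ∀ φ : ℝ, ε₂ < |θ - Real.pi / 2| → Ω (pt θ φ) = 1) ∧
    (∀ θ φ : ℝ, |θ - Real.pi / 2| < ε₁ → 0 < φ → φ < Real.pi / 2 → (∀ n, φ ≠ azimuth n) →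
      1 < Ω (pt θ φ))

/-- The region `V n`: the `g₀`-ball of diameter `ε n` about `q n`. -/
def V (ε : ℕ → ℝ) (n : ℕ) : Set S2 := geoBall (q n) (ε n / 2)

/-- The requirements on the sequences `ν` (heights) and `ε` (diameters). -/
structure IsChoice (ν ε : ℕ → ℝ) : Prop where
  ν_pos : ∀ n, 0 < ν n
  ν_anti : StrictAnti ν
  ν_lim : Tendsto ν atTop (𝓝 0)
  ε_pos : ∀ n, 0 < ε n
  ε_anti : StrictAnti ε
  ε_lim : Tendsto ε atTop (𝓝 0)
  p_notMem : ∀ m n, p m ∉ closure (V ε n)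
  disj : ∀ m n, m ≠ n → Disjoint (closure (V ε m)) (closure (V ε n))

/-- The requirements on the function `f` that is subtracted from `Ω`. -/
structure IsBump (ν ε : ℕ → ℝ) (f : S2 → ℝ) : Prop where
  smooth : ContMDiff (𝓡 2) 𝓘(ℝ, ℝ) ∞ f
  nonneg : ∀ x, 0 ≤ f x
  eq_zero : ∀ x, (∀ n, x ∉ V ε n) → f x = 0
  pos : ∀ n, 0 < f (q n)
  le : ∀ n, ∀ x ∈ V ε n, f x ≤ ν n

end SphereExample

end

/-! A curve between the poles through a point of the equator has round length at least $\pi$, so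
only a small excess is needed. Take `ε = diam`, a quarter of the gap between consecutive azimuths,
and `ν = diam / 64`. If the curve meets some ball, let $k$ be the least index met and $\delta$ the
diameter of that ball. The depths decrease, so the factor along the curve is at least $1-\delta/64$
(`IsBump.le_of_minimal`), while visiting both $p_n$ and the ball costs round length at least
$\pi+\delta$; the detour outweighs the gain (`pi_lt_conformalLength_of_visit`). If it meets no ball,
the factor along it is $\Omega\ge1$, and $\Omega>1$ near $p_n$ gives a strict excess
(`pi_lt_conformalLength_of_one_lt`). Both cases rest on `ofReal_mul_ang_le_conformalLength`, which
bounds length below by angular distance. -/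

namespace SphereExample

open InnerProductGeometry

/-! ### Angles and chords between unit vectors -/

section Angle

variable {E : Type*} [NormedAddCommGroup E] [InnerProductSpace ℝ E]

theorem norm_sub_eq_two_mul_sin_half_angle {x y : E} (hx : ‖x‖ = 1) (hy : ‖y‖ = 1) :
    ‖x - y‖ = 2 * Real.sin (angle x y / 2) := by
  have hs : 0 ≤ Real.sin (angle x y / 2) :=
    Real.sin_nonneg_of_nonneg_of_le_pi (by linarith [angle_nonneg x y])
      (by linarith [angle_le_pi x y, Real.pi_pos])
  have h1 : ‖x - y‖ ^ 2 = 2 - 2 * Real.cos (angle x y) := by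
    have h := norm_sub_sq_real x y
    have hc := cos_angle_mul_norm_mul_norm x y
    rw [hx, hy] at hc h
    linarith
  have h2 : Real.cos (angle x y) = 1 - 2 * Real.sin (angle x y / 2) ^ 2 := by
    have h := Real.cos_two_mul (angle x y / 2)
    rw [mul_div_cancel₀ _ (two_ne_zero)] at h
    linarith [Real.sin_sq_add_cos_sq (angle x y / 2)]
  refine (sq_eq_sq₀ (norm_nonneg _) (by positivity)).1 ?_
  rw [h1, h2]; ring

theorem norm_sub_le_angle {x y : E} (hx : ‖x‖ = 1) (hy : ‖y‖ = 1) : ‖x - y‖ ≤ angle x y := by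
  rw [norm_sub_eq_two_mul_sin_half_angle hx hy]
  linarith [Real.sin_le (x := angle x y / 2) (by linarith [angle_nonneg x y])]

theorem angle_le_mul_norm_sub {x y : E} (hx : ‖x‖ = 1) (hy : ‖y‖ = 1) :
    angle x y ≤ Real.pi / 2 * ‖x - y‖ := by
  rw [norm_sub_eq_two_mul_sin_half_angle hx hy]
  have h := Real.mul_le_sin (x := angle x y / 2) (by linarith [angle_nonneg x y])
    (by linarith [angle_le_pi x y])
  have hpi := Real.pi_pos
  calc angle x y = Real.pi * (2 / Real.pi * (angle x y / 2)) := by field_simp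
    _ ≤ Real.pi * Real.sin (angle x y / 2) := by gcongr
    _ = _ := by ring

theorem angle_eq_two_mul_arcsin {x y : E} (hx : ‖x‖ = 1) (hy : ‖y‖ = 1) :
    angle x y = 2 * Real.arcsin (‖x - y‖ / 2) := by
  rw [norm_sub_eq_two_mul_sin_half_angle hx hy, mul_div_cancel_left₀ _ two_ne_zero,
    Real.arcsin_sin (by linarith [angle_nonneg x y, Real.pi_pos]) (by linarith [angle_le_pi x y])]
  ring

theorem eventually_arcsin_le {η : ℝ} (hη : 0 < η) :
    ∀ᶠ u in 𝓝 (0 : ℝ), 0 ≤ u → Real.arcsin u ≤ (1 + η) * u := by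
  have h : HasDerivAt Real.arcsin 1 0 := by
    simpa using Real.hasDerivAt_arcsin (x := 0) (by norm_num) (by norm_num)
  filter_upwards [(hasDerivAt_iff_isLittleO.1 h).bound hη] with u hu hu0
  simp only [Real.arcsin_zero, sub_zero, smul_eq_mul, mul_one, Real.norm_eq_abs,
    abs_of_nonneg hu0] at hu
  linarith [le_abs_self (Real.arcsin u - u)]

end Angle

/-! ### Angular distance and lengths of absolutely continuous curves -/

theorem norm_coe (x : S2) : ‖(x : E3)‖ = 1 := mem_sphere_zero_iff_norm.1 x.2

/-- The distance of the round metric. -/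
noncomputable abbrev ang (x y : S2) : ℝ := angle (x : E3) (y : E3)

theorem ang_triangle (x y z : S2) : ang x z ≤ ang x y + ang y z := angle_le_angle_add_angle _ _ _

theorem dist_le_ang (x y : S2) : dist x y ≤ ang x y := by
  rw [Subtype.dist_eq, dist_eq_norm]
  exact norm_sub_le_angle (norm_coe x) (norm_coe y)

theorem ang_pos {x y : S2} (h : x ≠ y) : 0 < ang x y := (dist_pos.2 h).trans_le (dist_le_ang x y)

theorem abs_ang_sub_le (o x y : S2) : |ang o y - ang o x| ≤ ang x y := by
  rw [abs_le]
  constructor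
  · linarith [ang_triangle o y x, angle_comm (x : E3) (y : E3)]
  · linarith [ang_triangle o x y]

theorem continuous_ang (o : S2) : Continuous (ang o) := by
  unfold ang angle
  simp only [norm_coe]
  fun_prop

theorem absolutelyContinuousOnInterval_ang (o : S2) {γ : ℝ → S2} {a b : ℝ}
    (hγ : AbsolutelyContinuousOnInterval γ a b) :
    AbsolutelyContinuousOnInterval (fun t => ang o (γ t)) a b := by
  unfold AbsolutelyContinuousOnInterval at hγ ⊢
  have h := hγ.const_mul (Real.pi / 2)
  rw [mul_zero] at h
  refine squeeze_zero (fun E => Finset.sum_nonneg fun _ _ => dist_nonneg) (fun E => ?_) h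
  rw [Finset.mul_sum]
  gcongr with i
  rw [dist_comm, Real.dist_eq, Subtype.dist_eq, dist_eq_norm]
  exact (abs_ang_sub_le _ _ _).trans (angle_le_mul_norm_sub (norm_coe _) (norm_coe _))

theorem ae_differentiableAt_coe {γ : ℝ → S2} {a b : ℝ}
    (hγ : AbsolutelyContinuousOnInterval γ a b) :
    ∀ᵐ t, t ∈ uIcc a b → DifferentiableAt ℝ (fun s => (γ s : E3)) t := by
  have h : AbsolutelyContinuousOnInterval (fun s => (γ s : E3)) a b := hγ
  exact h.boundedVariationOn.ae_differentiableAt_of_mem_uIcc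

/-- The angle to a fixed point is 1-Lipschitz for the angular distance, and angle and chord agree to
first order. The Lipschitz bound against the chord alone would lose a factor $\pi/2$; the limit of
difference quotients removes it. -/
theorem abs_deriv_ang_le (o : S2) {γ : ℝ → S2} {t : ℝ}
    (hw : DifferentiableAt ℝ (fun s => ang o (γ s)) t)
    (hγ : DifferentiableAt ℝ (fun s => (γ s : E3)) t) :
    |deriv (fun s => ang o (γ s)) t| ≤ ‖deriv (fun s => (γ s : E3)) t‖ := by
  refine le_of_forall_pos_le_add fun η hη => ?_
  obtain ⟨κ, hκ, hκη⟩ : ∃ κ > 0, κ * ‖deriv (fun s => (γ s : E3)) t‖ ≤ η := by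
    refine ⟨η / (‖deriv (fun s => (γ s : E3)) t‖ + 1), by positivity, ?_⟩
    rw [div_mul_eq_mul_div, div_le_iff₀ (by positivity)]
    nlinarith
  have h1 := hw.hasDerivAt.tendsto_slope.abs
  have h2 := (hγ.hasDerivAt.tendsto_slope.norm).const_mul (1 + κ)
  have h3 : Tendsto (fun s => ‖(γ t : E3) - γ s‖ / 2) (𝓝[≠] t) (𝓝 0) := by
    have hc : ContinuousAt (fun s => ‖(γ t : E3) - γ s‖ / 2) t :=
      ((continuousAt_const.sub hγ.continuousAt).norm).div_const 2
    simpa using hc.tendsto.mono_left nhdsWithin_le_nhds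
  refine (le_of_tendsto_of_tendsto h1 h2 ?_).trans (by linarith)
  filter_upwards [h3.eventually (eventually_arcsin_le hκ)] with s hs
  have hs := hs (by positivity)
  have h4 : |ang o (γ s) - ang o (γ t)| ≤ (1 + κ) * ‖(γ s : E3) - γ t‖ := by
    refine (abs_ang_sub_le o (γ t) (γ s)).trans ?_
    rw [ang, angle_eq_two_mul_arcsin (norm_coe _) (norm_coe _), norm_sub_rev (γ s : E3)]
    linarith
  rw [slope_def_field, slope_def_module, norm_smul, abs_div, norm_inv, Real.norm_eq_abs,
    div_eq_inv_mul, mul_left_comm]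
  gcongr

theorem ofReal_ang_le_lintegral {γ : ℝ → S2} {s t : ℝ} (hst : s ≤ t)
    (hγ : AbsolutelyContinuousOnInterval γ s t) :
    ENNReal.ofReal (ang (γ s) (γ t)) ≤
      ∫⁻ u in Icc s t, ENNReal.ofReal ‖deriv (fun r => (γ r : E3)) u‖ := by
  set w : ℝ → ℝ := fun u => ang (γ s) (γ u) with hw
  have hwac : AbsolutelyContinuousOnInterval w s t := absolutelyContinuousOnInterval_ang _ hγ
  have h1 : ∫ u in s..t, deriv w u = ang (γ s) (γ t) := by
    rw [hwac.integral_deriv_eq_sub]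
    simp [hw, ang, angle_self (x := (γ s : E3)) (by rw [← norm_ne_zero_iff, norm_coe]; norm_num)]
  rw [← h1, intervalIntegral.integral_of_le hst, ← integral_Icc_eq_integral_Ioc]
  refine (ENNReal.ofReal_le_ofReal (le_abs_self _)).trans ?_
  rw [← Real.norm_eq_abs, ofReal_norm]
  refine (enorm_integral_le_lintegral_enorm _).trans ?_
  refine lintegral_mono_ae ((ae_restrict_iff' measurableSet_Icc).2 ?_)
  filter_upwards [ae_differentiableAt_coe hγ, hwac.boundedVariationOn.ae_differentiableAt_of_mem_uIcc]
    with u h2 h3 hu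
  rw [uIcc_of_le hst] at h2 h3
  rw [← ofReal_norm]
  exact ENNReal.ofReal_le_ofReal (abs_deriv_ang_le _ (h3 hu) (h2 hu))

theorem ofReal_mul_ang_le_conformalLength {h : S2 → ℝ} {γ : ℝ → S2} {s t c : ℝ} (hst : s ≤ t)
    (hγ : AbsolutelyContinuousOnInterval γ s t) (hc : 0 ≤ c)
    (hh : ∀ u ∈ Icc s t, c ^ 2 ≤ h (γ u)) :
    ENNReal.ofReal (c * ang (γ s) (γ t)) ≤ conformalLength h γ s t := by
  rw [ENNReal.ofReal_mul hc]
  grw [ofReal_ang_le_lintegral hst hγ]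
  rw [← lintegral_const_mul' _ _ ENNReal.ofReal_ne_top]
  refine setLIntegral_mono' measurableSet_Icc fun u hu => ?_
  rw [← ENNReal.ofReal_mul hc]
  refine ENNReal.ofReal_le_ofReal (Real.le_sqrt_of_sq_le ?_)
  rw [mul_pow]
  gcongr
  exact hh u hu

theorem conformalLength_add_le (h : S2 → ℝ) (γ : ℝ → S2) {r s t : ℝ} (hrs : r ≤ s) (hst : s ≤ t) :
    conformalLength h γ r s + conformalLength h γ s t ≤ conformalLength h γ r t := by
  unfold conformalLength
  -- Dropping the shared endpoint makes the two intervals disjoint.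
  rw [setLIntegral_congr (Ico_ae_eq_Icc (a := r) (b := s)).symm,
    ← lintegral_union measurableSet_Icc]
  · rw [Ico_union_Icc_eq_Icc hrs hst]
  · exact Set.disjoint_left.2 fun x hx hx' => absurd hx.2 (not_lt.2 hx'.1)

/-- A lower bound for the length of a curve through two intermediate points, with a separate lower
bound for the conformal factor on each of the three arcs. -/
theorem ofReal_le_conformalLength_of_three_arcs {h : S2 → ℝ} {γ : ℝ → S2} {a s t b c₁ c₂ c₃ : ℝ}
    (has : a ≤ s) (hst : s ≤ t) (htb : t ≤ b) (hγ : AbsolutelyContinuousOnInterval γ a b)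
    (hc₁ : 0 ≤ c₁) (hc₂ : 0 ≤ c₂) (hc₃ : 0 ≤ c₃)
    (h₁ : ∀ u ∈ Icc a s, c₁ ^ 2 ≤ h (γ u)) (h₂ : ∀ u ∈ Icc s t, c₂ ^ 2 ≤ h (γ u))
    (h₃ : ∀ u ∈ Icc t b, c₃ ^ 2 ≤ h (γ u)) :
    ENNReal.ofReal (c₁ * ang (γ a) (γ s) + c₂ * ang (γ s) (γ t) + c₃ * ang (γ t) (γ b)) ≤
      conformalLength h γ a b := by
  have hac : ∀ {r u}, r ∈ Icc a b → u ∈ Icc a b → AbsolutelyContinuousOnInterval γ r u :=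
    fun hr hu => hγ.mono (by rw [uIcc_of_le (has.trans (hst.trans htb))]; exact uIcc_subset_Icc hr hu)
  have ha : a ∈ Icc a b := ⟨le_rfl, has.trans (hst.trans htb)⟩
  have hb : b ∈ Icc a b := ⟨has.trans (hst.trans htb), le_rfl⟩
  have hs : s ∈ Icc a b := ⟨has, hst.trans htb⟩
  have ht : t ∈ Icc a b := ⟨has.trans hst, htb⟩
  grw [← conformalLength_add_le h γ (has.trans hst) htb, ← conformalLength_add_le h γ has hst,
    ENNReal.ofReal_add_le, ENNReal.ofReal_add_le,
    ofReal_mul_ang_le_conformalLength has (hac ha hs) hc₁ h₁,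
    ofReal_mul_ang_le_conformalLength hst (hac hs ht) hc₂ h₂,
    ofReal_mul_ang_le_conformalLength htb (hac ht hb) hc₃ h₃]

/-! ### Equatorial points and spacing of the azimuths -/

theorem ang_pt_equator {φ φ' : ℝ} (h₀ : 0 ≤ φ - φ') (h₁ : φ - φ' ≤ Real.pi) :
    ang (pt (Real.pi / 2) φ) (pt (Real.pi / 2) φ') = φ - φ' := by
  rw [ang, angle, norm_coe, norm_coe]
  rw [← Real.arccos_cos h₀ h₁, Real.cos_sub]
  congr 1
  simp [pt, PiLp.inner_apply, Fin.sum_univ_three]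
  ring

theorem ang_northPole_equator (φ : ℝ) : ang northPole (pt (Real.pi / 2) φ) = Real.pi / 2 := by
  rw [ang, ← inner_eq_zero_iff_angle_eq_pi_div_two]
  simp [pt, northPole, PiLp.inner_apply, Fin.sum_univ_three]

theorem ang_equator_southPole (φ : ℝ) : ang (pt (Real.pi / 2) φ) southPole = Real.pi / 2 := by
  rw [ang, ← inner_eq_zero_iff_angle_eq_pi_div_two]
  simp [pt, southPole, PiLp.inner_apply, Fin.sum_univ_three]

theorem azimuth_pos (n : ℕ) : 0 < azimuth n := by
  unfold azimuth
  have := Real.pi_pos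
  positivity

theorem azimuth_strictAnti : StrictAnti azimuth := by
  refine strictAnti_nat_of_succ_lt fun n => ?_
  unfold azimuth
  have := Real.pi_pos
  push_cast
  gcongr
  linarith

theorem azimuth_lt_one (n : ℕ) : azimuth n < 1 := by
  refine (azimuth_strictAnti.antitone (Nat.zero_le n)).trans_lt ?_
  unfold azimuth
  rw [div_lt_one (by positivity)]
  push_cast
  linarith [Real.pi_gt_three]

theorem tendsto_azimuth : Tendsto azimuth atTop (𝓝 0) := by
  have h := (tendsto_one_div_add_atTop_nhds_zero_nat (𝕜 := ℝ)).mul_const Real.pi⁻¹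
  rw [zero_mul] at h
  refine h.congr fun n => ?_
  rw [azimuth, one_div, one_div, mul_inv]

/-- The diameters of the balls `V n`. -/
noncomputable def diam (n : ℕ) : ℝ := (azimuth n - azimuth (n + 1)) / 4

theorem diam_eq (n : ℕ) : diam n = 1 / (4 * Real.pi * ((n + 1) * (n + 2))) := by
  have := Real.pi_pos
  unfold diam azimuth
  push_cast
  field_simp
  ring

theorem diam_pos (n : ℕ) : 0 < diam n := by
  have := azimuth_strictAnti (Nat.lt_succ_self n)
  unfold diam
  linarith

theorem diam_strictAnti : StrictAnti diam := by
  refine strictAnti_nat_of_succ_lt fun n => ?_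
  have := Real.pi_pos
  rw [diam_eq, diam_eq]
  push_cast
  gcongr <;> linarith

theorem tendsto_diam : Tendsto diam atTop (𝓝 0) := by
  have h := (tendsto_azimuth.sub (tendsto_azimuth.comp (tendsto_add_atTop_nat 1))).div_const 4
  rw [sub_zero, zero_div] at h
  exact h

theorem four_mul_diam_le_azimuth (n : ℕ) : 4 * diam n ≤ azimuth n := by
  unfold diam
  linarith [azimuth_pos (n + 1)]

theorem diam_lt_one (n : ℕ) : diam n < 1 := by
  linarith [four_mul_diam_le_azimuth n, azimuth_lt_one n, diam_pos n]

/-- Both sides are of order $n^{-2}$; this makes a multiple of a squared coordinate small enough to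
serve as the bump's height. -/
theorem azimuth_sq_le (n : ℕ) : azimuth n ^ 2 ≤ 4 * diam n := by
  have h := Real.pi_gt_three
  rw [diam_eq, azimuth, div_pow, mul_one_div, div_le_div_iff₀ (by positivity) (by positivity)]
  have h2 : (0 : ℝ) ≤ n := n.cast_nonneg
  have h3 : ((n : ℝ) + 2) ≤ Real.pi * (n + 1) := by nlinarith
  have h4 : 0 ≤ 4 * Real.pi * ((n : ℝ) + 1) := by positivity
  nlinarith [mul_le_mul_of_nonneg_left h3 h4]

theorem four_mul_diam_le_ang_q {m n : ℕ} (h : m < n) : 4 * diam m ≤ ang (q m) (q n) := by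
  have h1 : azimuth n ≤ azimuth (m + 1) := azimuth_strictAnti.antitone (Nat.succ_le_of_lt h)
  have h2 := azimuth_strictAnti h
  rw [q, q, ang_pt_equator (by linarith)
    (by linarith [azimuth_lt_one m, azimuth_pos n, Real.pi_gt_three])]
  unfold diam
  linarith [h1]

/-- The azimuth of `p n`. -/
noncomputable def midAzimuth (n : ℕ) : ℝ := (azimuth n + azimuth (n + 1)) / 2

theorem midAzimuth_pos (n : ℕ) : 0 < midAzimuth n := by
  unfold midAzimuth
  linarith [azimuth_pos n, azimuth_pos (n + 1)]

theorem midAzimuth_lt_one (n : ℕ) : midAzimuth n < 1 := by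
  unfold midAzimuth
  linarith [azimuth_lt_one n, azimuth_lt_one (n + 1)]

theorem two_mul_diam_le_azimuth_sub_mid {m n : ℕ} (h : m ≤ n) :
    2 * diam m ≤ azimuth m - midAzimuth n := by
  have h1 := azimuth_strictAnti.antitone h
  have h2 : azimuth (n + 1) ≤ azimuth (m + 1) := azimuth_strictAnti.antitone (Nat.succ_le_succ h)
  unfold diam midAzimuth
  linarith

/-- The midpoint is `2 * diam n` above `azimuth (n + 1)`, and `diam m` is the smaller diameter. -/
theorem two_mul_diam_le_mid_sub_azimuth {m n : ℕ} (h : n < m) :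
    2 * diam m ≤ midAzimuth n - azimuth m := by
  have h1 : azimuth m ≤ azimuth (n + 1) := azimuth_strictAnti.antitone (Nat.succ_le_of_lt h)
  have h2 := diam_strictAnti.antitone h.le
  have h3 : 2 * diam n = midAzimuth n - azimuth (n + 1) := by unfold diam midAzimuth; ring
  linarith

theorem midAzimuth_ne_azimuth (m n : ℕ) : midAzimuth n ≠ azimuth m := by
  have h := diam_pos m
  rcases le_or_gt m n with hmn | hmn
  · linarith [two_mul_diam_le_azimuth_sub_mid hmn]
  · linarith [two_mul_diam_le_mid_sub_azimuth hmn]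

theorem p_eq (n : ℕ) : p n = pt (Real.pi / 2) (midAzimuth n) := rfl

theorem two_mul_diam_le_ang_q_p (m n : ℕ) : 2 * diam m ≤ ang (q m) (p n) := by
  have h := diam_pos m
  have h3 := Real.pi_gt_three
  rcases le_or_gt m n with hmn | hmn
  · have h1 := two_mul_diam_le_azimuth_sub_mid hmn
    rw [q, p_eq, ang_pt_equator (by linarith) (by linarith [azimuth_lt_one m, midAzimuth_pos n])]
    exact h1
  · have h1 := two_mul_diam_le_mid_sub_azimuth hmn
    rw [ang, angle_comm, ← ang, q, p_eq,
      ang_pt_equator (by linarith) (by linarith [midAzimuth_lt_one n, azimuth_pos m])]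
    exact h1

/-! ### The balls and the existence of an admissible function -/

theorem isOpen_V (ε : ℕ → ℝ) (n : ℕ) : IsOpen (V ε n) :=
  isOpen_lt (continuous_ang (q n)) continuous_const

theorem ang_le_of_mem_closure_V {ε : ℕ → ℝ} {n : ℕ} {x : S2} (hx : x ∈ closure (V ε n)) :
    ang (q n) x ≤ ε n / 2 :=
  closure_minimal (fun _ hy => le_of_lt hy)
    (isClosed_le (continuous_ang (q n)) continuous_const) hx

theorem q_mem_V {ε : ℕ → ℝ} {n : ℕ} (h : 0 < ε n) : q n ∈ V ε n := by
  change angle (q n : E3) (q n : E3) < _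
  rw [angle_self (by rw [← norm_ne_zero_iff, norm_coe]; norm_num)]
  linarith

theorem disjoint_closure_V_of_lt {m n : ℕ} (h : m < n) :
    Disjoint (closure (V diam m)) (closure (V diam n)) := by
  refine Set.disjoint_left.2 fun x hm hn => ?_
  have h1 := ang_le_of_mem_closure_V hm
  have h2 := ang_le_of_mem_closure_V hn
  rw [ang, angle_comm, ← ang] at h2
  linarith [ang_triangle (q m) x (q n), four_mul_diam_le_ang_q h,
    diam_strictAnti h, diam_pos n]

theorem isChoice_diam : IsChoice (fun n => diam n / 64) diam where
  ν_pos n := by linarith [diam_pos n]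
  ν_anti m n h := by
    have := diam_strictAnti h
    dsimp only
    linarith
  ν_lim := by simpa using tendsto_diam.div_const 64
  ε_pos := diam_pos
  ε_anti := diam_strictAnti
  ε_lim := tendsto_diam
  p_notMem m n h := by
    linarith [ang_le_of_mem_closure_V h, two_mul_diam_le_ang_q_p n m, diam_pos n]
  disj m n h := by
    rcases h.lt_or_gt with h | h
    · exact disjoint_closure_V_of_lt h
    · exact (disjoint_closure_V_of_lt h).symm

theorem abs_coord_one_le {n : ℕ} {x : S2} (hx : x ∈ V diam n) : |(x : E3) 1| ≤ 2 * azimuth n := by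
  have h1 : |(x : E3) 1 - (q n : E3) 1| ≤ dist x (q n) := by
    rw [Subtype.dist_eq, dist_eq_norm]
    exact PiLp.norm_apply_le ((x : E3) - (q n : E3)) 1
  have h2 : dist x (q n) ≤ diam n / 2 := by
    rw [dist_comm]
    exact (dist_le_ang _ _).trans (le_of_lt hx)
  have h3 : (q n : E3) 1 = Real.sin (azimuth n) := by simp [q, pt]
  have h4 := Real.abs_sin_le_abs (x := azimuth n)
  rw [abs_of_pos (azimuth_pos n), ← h3] at h4
  have h5 := abs_sub_abs_le_abs_sub ((x : E3) 1) ((q n : E3) 1)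
  linarith [four_mul_diam_le_azimuth n, diam_pos n]

theorem exists_isBump : ∃ f : S2 → ℝ, IsBump (fun n => diam n / 64) diam f := by
  obtain ⟨U, hU, hUV⟩ := isOpen_induced_iff.1 (isOpen_iUnion fun n => isOpen_V diam n)
  -- One cutoff with support exactly $U$ handles all the balls, so smoothness at their accumulation
  -- point needs no infinite sum.
  obtain ⟨χ, hχU, hχ, hχr⟩ := hU.exists_contDiff_support_eq (n := ⊤)
  have hχ0 : ∀ x, 0 ≤ χ x := fun x => (hχr ⟨x, rfl⟩).1
  have hχ1 : ∀ x, χ x ≤ 1 := fun x => (hχr ⟨x, rfl⟩).2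
  have hmem : ∀ x : S2, χ x ≠ 0 ↔ ∃ n, x ∈ V diam n := fun x => by
    rw [← Function.mem_support, hχU, ← mem_iUnion, ← hUV, mem_preimage]
  -- The factor $y^2$ supplies the decay: on the $n$-th ball $y^2\le 4\,$`azimuth n ^ 2`$\,\le
  -- 16\,$`diam n`, and $16/1024=1/64$.
  have hF : ContDiff ℝ ∞ fun x : E3 => χ x * (x 1 ^ 2 / 1024) := by
    refine hχ.mul ?_
    fun_prop
  refine ⟨fun x => χ x * ((x : E3) 1 ^ 2 / 1024), ?_, fun x => ?_, fun x hx => ?_, fun n => ?_,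
    fun n x hx => ?_⟩
  · have : Fact (Module.finrank ℝ E3 = 2 + 1) := ⟨by simp⟩
    exact hF.contMDiff.comp contMDiff_coe_sphere
  · have := hχ0 x
    positivity
  · have h : χ x = 0 := by
      by_contra h
      obtain ⟨n, hn⟩ := (hmem x).1 h
      exact hx n hn
    simp [h]
  · have h1 : 0 < χ (q n) := (hχ0 _).lt_of_ne' ((hmem _).2 ⟨n, q_mem_V (diam_pos n)⟩)
    have h2 : (q n : E3) 1 = Real.sin (azimuth n) := by simp [q, pt]
    have h3 : 0 < Real.sin (azimuth n) :=
      Real.sin_pos_of_pos_of_lt_pi (azimuth_pos n)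
        (by linarith [azimuth_lt_one n, Real.pi_gt_three])
    rw [h2]
    positivity
  · have h1 := abs_coord_one_le hx
    have h2 : (x : E3) 1 ^ 2 ≤ (2 * azimuth n) ^ 2 := sq_le_sq' (by linarith [neg_abs_le ((x : E3) 1)])
      (by linarith [le_abs_self ((x : E3) 1)])
    have h3 := azimuth_sq_le n
    calc χ x * ((x : E3) 1 ^ 2 / 1024) ≤ 1 * ((x : E3) 1 ^ 2 / 1024) := by
          gcongr
          exact hχ1 _
      _ ≤ diam n / 64 := by linarith

/-! ### Curves through a midpoint are too long -/

theorem IsBump.le_of_minimal {ν ε : ℕ → ℝ} {f : S2 → ℝ} (hf : IsBump ν ε f) (hν : Antitone ν)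
    {k : ℕ} (hk : 0 ≤ ν k) {x : S2} (hx : ∀ j < k, x ∉ V ε j) : f x ≤ ν k := by
  by_cases h : ∃ j, x ∈ V ε j
  · obtain ⟨j, hj⟩ := h
    exact (hf.le j x hj).trans (hν (not_lt.1 fun hjk => hx j hjk hj))
  · push Not at h
    rw [hf.eq_zero x h]
    exact hk

theorem IsBaseFactor.one_lt_p {Ω : S2 → ℝ} (hΩ : IsBaseFactor Ω) (n : ℕ) : 1 < Ω (p n) := by
  obtain ⟨ε₁, ε₂, h1, -, -, -, h2⟩ := hΩ.band
  rw [p_eq]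
  exact h2 _ _ (by simpa using h1) (midAzimuth_pos n)
    (by linarith [midAzimuth_lt_one n, Real.pi_gt_three]) fun m => midAzimuth_ne_azimuth m n

theorem exists_isLeast_fiber {X : Type*} [TopologicalSpace X] [T1Space X] {γ : ℝ → X} {a b : ℝ}
    {P : X} (hγ : ContinuousOn γ (Icc a b)) (hP : ∃ t ∈ Icc a b, γ t = P) :
    ∃ t, IsLeast (Icc a b ∩ γ ⁻¹' {P}) t :=
  (isCompact_Icc.of_isClosed_subset
    (hγ.preimage_isClosed_of_isClosed isClosed_Icc isClosed_singleton)
    inter_subset_left).exists_isLeast hP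

/-- A curve from pole to pole through a point of the equator where the conformal factor exceeds `1`
is longer than a meridian. -/
theorem pi_lt_conformalLength_of_one_lt {h : S2 → ℝ} (hcont : Continuous h) {γ : ℝ → S2} {a b : ℝ}
    {P : S2} (hN : ang northPole P = Real.pi / 2) (hS : ang P southPole = Real.pi / 2) (hab : a ≤ b) (hγ : AbsolutelyContinuousOnInterval γ a b) (ha : γ a = northPole)
    (hb : γ b = southPole) (hp : ∃ t ∈ Icc a b, γ t = P)
    (h1 : 1 < h P) {g : S2 → ℝ} (hg : ∀ t ∈ Icc a b, g (γ t) = h (γ t))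
    (hone : ∀ x, 1 ≤ h x) :
    ENNReal.ofReal Real.pi < conformalLength g γ a b := by
  have hγc : ContinuousOn γ (Icc a b) := by
    rw [← uIcc_of_le hab]
    have hcoe : AbsolutelyContinuousOnInterval (fun s => (γ s : E3)) a b := hγ
    exact Topology.IsInducing.subtypeVal.continuousOn_iff.2 hcoe.continuousOn
  -- At the first arrival at $P$ every earlier point differs from $P$, so a short arc ending there
  -- has positive angular extent.
  obtain ⟨t, ⟨ht, hmin⟩⟩ : ∃ t, IsLeast (Icc a b ∩ γ ⁻¹' {P}) t :=
    exists_isLeast_fiber hγc hp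
  have htP : γ t = P := ht.2
  have hat : a < t := by
    refine ht.1.1.lt_of_ne fun h => ?_
    rw [← htP, ← h, ← ha, ang,
      angle_self (by rw [← norm_ne_zero_iff, norm_coe]; norm_num)] at hN
    linarith [Real.pi_pos]
  obtain ⟨c, hc1, hc2⟩ : ∃ c : ℝ, 1 < c ∧ c ^ 2 < h P := by
    refine ⟨√((1 + h P) / 2), ?_, ?_⟩
    · rw [Real.lt_sqrt zero_le_one]; linarith
    · rw [Real.sq_sqrt (by linarith)]; linarith
  have hev : ∀ᶠ u in 𝓝[Icc a b] t, c ^ 2 < h (γ u) := by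
    have hct : ContinuousWithinAt (fun u => h (γ u)) (Icc a b) t :=
      hcont.continuousAt.comp_continuousWithinAt (hγc t ht.1)
    refine hct.eventually_const_lt ?_
    simpa only [htP] using hc2
  obtain ⟨δ, hδ, hball⟩ := Metric.mem_nhdsWithin_iff.1 hev
  obtain ⟨s, hs1, hst, hs2⟩ : ∃ s, a ≤ s ∧ s < t ∧ t - s < δ :=
    ⟨max a (t - δ / 2), le_max_left _ _, max_lt hat (by linarith),
      by linarith [le_max_right a (t - δ / 2)]⟩
  have hnear : ∀ u ∈ Icc s t, c ^ 2 ≤ g (γ u) := fun u hu => by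
    have hu' : u ∈ Icc a b := ⟨hs1.trans hu.1, hu.2.trans ht.1.2⟩
    rw [hg u hu']
    refine le_of_lt (hball ⟨?_, hu'⟩)
    rw [Metric.mem_ball, Real.dist_eq, abs_lt]
    constructor <;> linarith [hu.1, hu.2]
  have hfar : ∀ u ∈ Icc a b, (1 : ℝ) ^ 2 ≤ g (γ u) := fun u hu => by
    rw [hg u hu, one_pow]; exact hone _
  have hpos : 0 < ang (γ s) (γ t) := ang_pos fun h => by
    have hmem : s ∈ Icc a b ∩ γ ⁻¹' {P} := ⟨⟨hs1, hst.le.trans ht.1.2⟩, h.trans htP⟩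
    exact absurd (hmin hmem) (not_le.2 hst)
  refine LT.lt.trans_le ?_ (ofReal_le_conformalLength_of_three_arcs hs1 hst.le ht.1.2 hγ
    zero_le_one (by linarith : 0 ≤ c) zero_le_one
    (fun u hu => hfar u ⟨hu.1, hu.2.trans (hst.le.trans ht.1.2)⟩) hnear
    (fun u hu => hfar u ⟨ht.1.1.trans hu.1, hu.2⟩))
  have h2 := ang_triangle (γ a) (γ s) (γ t)
  have h3 : ang (γ a) (γ t) = Real.pi / 2 := by rw [ha, htP, hN]
  have h4 : ang (γ t) (γ b) = Real.pi / 2 := by rw [hb, htP, hS]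
  rw [ENNReal.ofReal_lt_ofReal_iff_of_nonneg Real.pi_pos.le]
  nlinarith

/-- A curve from pole to pole through two points near the equator at distance at least `3δ/2` is
longer than a meridian, even if the conformal factor is slightly smaller than `1`. -/
theorem pi_lt_conformalLength_of_detour {g : S2 → ℝ} {γ : ℝ → S2} {a s t b δ : ℝ}
    (has : a ≤ s) (hst : s ≤ t) (htb : t ≤ b) (hγ : AbsolutelyContinuousOnInterval γ a b)
    (hδ : 0 < δ) (hδ1 : δ < 1) (hg : ∀ u ∈ Icc a b, 1 - δ / 64 ≤ g (γ u))
    (h : Real.pi + δ ≤ ang (γ a) (γ s) + ang (γ s) (γ t) + ang (γ t) (γ b)) :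
    ENNReal.ofReal Real.pi < conformalLength g γ a b := by
  have hc : 0 ≤ 1 - δ / 64 := by linarith
  have hg' : ∀ u ∈ Icc a b, (1 - δ / 64) ^ 2 ≤ g (γ u) := fun u hu => by
    refine le_trans ?_ (hg u hu)
    -- $c^2\le c$ for $0\le c\le1$, so $c$ itself bounds the square root of the factor.
    nlinarith
  refine LT.lt.trans_le ?_ (ofReal_le_conformalLength_of_three_arcs has hst htb hγ hc hc hc
    (fun u hu => hg' u ⟨hu.1, hu.2.trans (hst.trans htb)⟩)
    (fun u hu => hg' u ⟨has.trans hu.1, hu.2.trans htb⟩)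
    (fun u hu => hg' u ⟨(has.trans hst).trans hu.1, hu.2⟩))
  rw [ENNReal.ofReal_lt_ofReal_iff_of_nonneg Real.pi_pos.le]
  have h2 := mul_le_mul_of_nonneg_left h hc
  -- $(1-\delta/64)(\pi+\delta)-\pi=\delta\,(1-(\pi+\delta)/64)>0$ because $\pi+\delta<5$.
  nlinarith [Real.pi_lt_four, Real.pi_pos]

theorem pi_lt_conformalLength_of_visit {g : S2 → ℝ} {γ : ℝ → S2} {a b : ℝ} {k n : ℕ}
    (hγ : AbsolutelyContinuousOnInterval γ a b) (ha : γ a = northPole) (hb : γ b = southPole)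
    {s t : ℝ} (hs : s ∈ Icc a b) (ht : t ∈ Icc a b) (hps : γ s = p n) (hVt : γ t ∈ V diam k)
    (hg : ∀ u ∈ Icc a b, 1 - diam k / 64 ≤ g (γ u)) :
    ENNReal.ofReal Real.pi < conformalLength g γ a b := by
  have hq : ang (q k) (γ t) < diam k / 2 := hVt
  have hqp := two_mul_diam_le_ang_q_p k n
  have hN : ang northPole (q k) = Real.pi / 2 := ang_northPole_equator _
  have hS : ang (q k) southPole = Real.pi / 2 := ang_equator_southPole _
  have hNp : ang northPole (p n) = Real.pi / 2 := ang_northPole_equator _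
  have hpS : ang (p n) southPole = Real.pi / 2 := ang_equator_southPole _
  have hc : ang (γ t) (q k) = ang (q k) (γ t) := angle_comm _ _
  have hc' : ang (p n) (γ t) = ang (γ t) (p n) := angle_comm _ _
  have h1 := ang_triangle (q k) (γ t) (p n)
  -- With $\delta$ = `diam k`, the leg between `p n` and `γ t` is at least $2\delta-\delta/2$, the
  -- leg from `γ t` to its pole at least $\pi/2-\delta/2$, and the remaining leg is $\pi/2$: in
  -- total $\pi+\delta$ in either order.
  rcases le_total s t with hst | hst
  · refine pi_lt_conformalLength_of_detour hs.1 hst ht.2 hγ (diam_pos k) (diam_lt_one k) hg ?_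
    rw [ha, hb, hps]
    linarith [ang_triangle (q k) (γ t) southPole]
  · refine pi_lt_conformalLength_of_detour ht.1 hst hs.2 hγ (diam_pos k) (diam_lt_one k) hg ?_
    rw [ha, hb, hps]
    linarith [ang_triangle northPole (γ t) (q k)]

end SphereExample

theorem claim3p2 (Ω : SphereExample.S2 → ℝ) (hΩ : SphereExample.IsBaseFactor Ω) :
    ∃ ν ε : ℕ → ℝ, SphereExample.IsChoice ν ε ∧
      (∃ f : SphereExample.S2 → ℝ, SphereExample.IsBump ν ε f) ∧
      ∀ f : SphereExample.S2 → ℝ, SphereExample.IsBump ν ε f →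
        (∀ x, 0 < Ω x - f x) ∧
        ∀ (a b : ℝ) (γ : ℝ → SphereExample.S2), a ≤ b → AbsolutelyContinuousOnInterval γ a b →
          ¬ ((γ a = SphereExample.northPole ∧ γ b = SphereExample.southPole) ∧
            (∃ n : ℕ, ∃ t ∈ Set.Icc a b, γ t = SphereExample.p n) ∧
            SphereExample.conformalLength (fun x => Ω x - f x) γ a b
              ≤ ENNReal.ofReal Real.pi) := by
  open SphereExample in
  refine ⟨fun n => diam n / 64, diam, isChoice_diam, exists_isBump, fun f hf => ⟨fun x => ?_, ?_⟩⟩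
  -- With $k=0$ no ball has to be avoided, so the bound holds on the whole sphere.
  · have h1 : f x ≤ diam 0 / 64 :=
      hf.le_of_minimal isChoice_diam.ν_anti.antitone (isChoice_diam.ν_pos 0).le (by simp)
    linarith [hΩ.one_le x, diam_lt_one 0]
  · rintro a b γ hab hγ ⟨⟨ha, hb⟩, ⟨n, s, hs, hps⟩, hL⟩
    refine absurd hL (not_le.2 ?_)
    by_cases hvisit : ∃ k, ∃ t ∈ Icc a b, γ t ∈ V diam k
    · classical
      -- The least index visited gives the deepest bound $\nu_k$ that can occur along the whole
      -- curve, matched to the detour through that same ball.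
      obtain ⟨t, ht, hVt⟩ := Nat.find_spec hvisit
      refine pi_lt_conformalLength_of_visit hγ ha hb hs ht hps hVt fun u hu => ?_
      have h1 : f (γ u) ≤ diam (Nat.find hvisit) / 64 :=
        hf.le_of_minimal isChoice_diam.ν_anti.antitone (isChoice_diam.ν_pos _).le
          fun j hj hV => Nat.find_min hvisit hj ⟨u, hu, hV⟩
      linarith [hΩ.one_le (γ u)]
    · push Not at hvisit
      refine pi_lt_conformalLength_of_one_lt hΩ.smooth.continuous
        (ang_northPole_equator _) (ang_equator_southPole _) hab hγ ha hb ⟨s, hs, hps⟩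
        (hΩ.one_lt_p n) (fun t ht => ?_) hΩ.one_le
      rw [hf.eq_zero _ fun k => hvisit k t ht, sub_zero]
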